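/- Let $\Sigma$ be a finite input alphabet and $\Gamma=\Sigma\cup\{\text{¢},\$\}$ with two end-markers; every automaton below has $n\ge 1$ states, starts in state $q_1$, and on input $w\in\Sigma^*$ reads the symbols of $\text{¢}\,w\,\$$ from left to right. A probabilistic finite automaton (PFA) has a real row-stochastic $n\times n$ matrix $A_\sigma$ for each $\sigma\in\Gamma$ and a set $F$ of accepting states; $f(w)$ is the sum over $F$ of the entries of the vector $(1,0,\dots,0)A_{\text{¢}}A_{w_1}\cdots A_{w_{|w|}}A_{\$}$. The class $S^{\neq}$ of exclusive stochastic languages over $\Sigma$ consists of the languages $\{w : f(w)\neq\lambda\}$ for a PFA and a $\lambda\in[0,1]$. A Kondacs–Watrous quantum finite automaton (KWQFA) has a complex unitary $n\times n$ matrix $U_\sigma$ for each $\sigma\in\Gamma$ and disjoint sets of accepting and rejecting states. For each symbol read, $U_\sigma$ is applied to the state vector, then each accepting state with amplitude $\alpha$ adds $|\alpha|^2$ to the acceptance probability $f(w)$, and the amplitudes of all accepting and rejecting states are replaced by $0$. The class $\mathrm{NQL}$ consists of the languages $\{w : f(w)>0\}$ for a KWQFA. A quantum finite automaton with ancilla qubits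 (QFA-A) has a finite set $\Omega$ of ancilla (output) symbols, amplitudes $\delta(q,\sigma,p,\omega)\in\mathbb{C}$ for states $q,p$, $\sigma\in\Gamma$, $\omega\in\Omega$ with $$\sum_{p,\omega}\overline{\delta(q,\sigma,p,\omega)}\,\delta(q',\sigma,p,\omega)=\begin{cases}1,& q=q',\\ 0,& q\ne q',\end{cases}$$ and a set of accepting states. When reading $\sigma$ in state $q$ it moves to $p$ and leaves $\omega$ in a fresh ancilla register, never used again, with amplitude $\delta(q,\sigma,p,\omega)$; $f(w)$ is the probability that a measurement after the whole tape has been read finds an accepting state, that is, the sum of the squared moduli of the amplitudes of all pairs (accepting state, word of ancilla symbols). The class $\mathrm{QFA\text{-}A}_0$ consists of the languages $\{w : f(w)>0\}$ for a QFA-A. Then, for every finite alphabet $\Sigma$, $$\mathrm{QFA\text{-}A}_0=\mathrm{NQL}=S^{\neq}.$$ -/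

import Mathlib

open scoped Matrix

namespace NQFA

/-- The tape alphabet `Γ = Σ ∪ {¢, $}`: the input symbols and the two end-markers. -/
inductive TapeSym (α : Type*) where
  | cent : TapeSym α
  | sym : α → TapeSym α
  | dollar : TapeSym α

/-- The tape content `¢ w $` for the input word `w`. -/
def tape {α : Type*} (w : List α) : List (TapeSym α) :=
  TapeSym.cent :: (w.map TapeSym.sym ++ [TapeSym.dollar])

section Cutpoints

variable {α : Type*}

/-- The words whose value is smaller than the cutpoint. -/
def langLT (f : List α → ℝ) (c : ℝ) : Language α := {w | f w < c}

/-- The words whose value is greater than the cutpoint: the language recognized with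
cutpoint `c`. -/
def langGT (f : List α → ℝ) (c : ℝ) : Language α := {w | c < f w}

/-- The words whose value differs from the cutpoint. -/
def langNE (f : List α → ℝ) (c : ℝ) : Language α := langLT f c ⊔ langGT f c

end Cutpoints

/-! ### Probabilistic finite automata -/

/-- A one-way probabilistic finite automaton with state set `Fin n`: a row-stochastic
matrix `A σ` for every tape symbol (`A σ i j` is the probability of moving from `i` to `j`),
and a set of accepting states. The start state is `0`. -/
structure PFA (α : Type*) (n : ℕ) where
  A : TapeSym α → Matrix (Fin n) (Fin n) ℝ
  stochastic : ∀ σ, A σ ∈ Matrix.rowStochastic ℝ (Fin n)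
  acc : Finset (Fin n)

namespace PFA

variable {α : Type*} {n : ℕ}

/-- The row vector reached from `v` by reading `x`. -/
noncomputable def run (P : PFA α n) (v : Fin n → ℝ) (x : List (TapeSym α)) : Fin n → ℝ :=
  x.foldl (fun v σ => v ᵥ* P.A σ) v

/-- The acceptance probability of the input word `w`. -/
noncomputable def acceptProb [NeZero n] (P : PFA α n) (w : List α) : ℝ :=
  ∑ i ∈ P.acc, P.run (Pi.single 0 1) (tape w) i

end PFA

/-- The exclusive stochastic languages over `α`: the class `S^≠`. -/
def SNe (α : Type*) : Set (Language α) :=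
  {L | ∃ (n : ℕ) (_ : NeZero n) (P : PFA α n) (c : ℝ),
    c ∈ Set.Icc (0 : ℝ) 1 ∧ L = langNE P.acceptProb c}

/-! ### Kondacs–Watrous quantum finite automata -/

/-- A one-way Kondacs–Watrous quantum finite automaton with state set `Fin n`: a unitary
matrix `U σ` for every tape symbol (`U σ j i` is the amplitude of moving from `i` to `j`),
and disjoint sets of accepting and of rejecting states. The start state is `0`. -/
structure KWQFA (α : Type*) (n : ℕ) where
  U : TapeSym α → Matrix (Fin n) (Fin n) ℂ
  unitary : ∀ σ, U σ ∈ Matrix.unitaryGroup (Fin n) ℂ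
  acc : Finset (Fin n)
  rej : Finset (Fin n)
  disjoint : Disjoint acc rej

namespace KWQFA

variable {α : Type*} {n : ℕ}

/-- Halting states drop out of the state vector: their amplitudes are replaced by `0`. -/
noncomputable def nonHalting (M : KWQFA α n) (ψ : Fin n → ℂ) : Fin n → ℂ :=
  fun q => if q ∈ M.acc ∪ M.rej then 0 else ψ q

/-- The total acceptance probability collected while reading `x` from the (unnormalized)
state vector `ψ`: after each symbol the machine is observed, every accepting state
contributes the squared modulus of its amplitude, and the computation continues with the
non-halting part. -/
noncomputable def acceptFrom (M : KWQFA α n) : (Fin n → ℂ) → List (TapeSym α) → ℝ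
  | _, [] => 0
  | ψ, σ :: x =>
      (∑ q ∈ M.acc, ‖(M.U σ *ᵥ ψ) q‖ ^ 2) + M.acceptFrom (M.nonHalting (M.U σ *ᵥ ψ)) x

/-- The acceptance probability of the input word `w`. -/
noncomputable def acceptProb [NeZero n] (M : KWQFA α n) (w : List α) : ℝ :=
  M.acceptFrom (Pi.single 0 1) (tape w)

end KWQFA

/-- The languages over `α` recognized with cutpoint `0` by Kondacs–Watrous automata:
the class `NQL`. -/
def NQL (α : Type*) : Set (Language α) :=
  {L | ∃ (n : ℕ) (_ : NeZero n) (M : KWQFA α n), L = langGT M.acceptProb 0}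

/-! ### Quantum finite automata with ancilla qubits -/

/-- A one-way quantum finite automaton with ancilla qubits, with state set `Fin n`.
In every step a fresh ancilla register, with computational basis `Fin k`, is supplied in a
fixed state; the step acts on the state and on this register, which is not used again in
later steps (the ancilla contents form a write-only output word over `Fin k`).
`δ q σ p ω` is the amplitude of moving from the state `q` to `p` and leaving `ω` in the fresh
register when `σ` is read. The condition `wellFormed` says that
`|q⟩ ↦ ∑ p ω, δ q σ p ω |p⟩|ω⟩` is an isometry, that is, the restriction of a unitary operator
on state and ancilla to the fixed initial state of the ancilla. The start state is `0`. -/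
structure QFAA (α : Type*) (n k : ℕ) where
  δ : Fin n → TapeSym α → Fin n → Fin k → ℂ
  wellFormed : ∀ σ q₁ q₂,
    ∑ p, ∑ ω, (starRingEnd ℂ) (δ q₁ σ p ω) * δ q₂ σ p ω = if q₁ = q₂ then 1 else 0
  acc : Finset (Fin n)

namespace QFAA

variable {α : Type*} {n k : ℕ}

/-- One step on the amplitudes, in the branch in which the symbol `ω` is left in the fresh
ancilla register. -/
noncomputable def step (M : QFAA α n k) (ψ : Fin n → ℂ) (s : TapeSym α × Fin k) : Fin n → ℂ :=
  fun p => ∑ q, M.δ q s.1 p s.2 * ψ q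

/-- `M.amplitude x y p` is the amplitude, after reading the tape word `x` from the start
state, of the configuration with state `p` and ancilla contents `y`
(one symbol per step). -/
noncomputable def amplitude [NeZero n] (M : QFAA α n k) (x : List (TapeSym α))
    (y : Fin x.length → Fin k) : Fin n → ℂ :=
  (x.zip (List.ofFn y)).foldl M.step (Pi.single 0 1)

/-- The acceptance probability of the input word `w`: the probability that a measurement
after reading the whole tape finds an accepting state, whatever the ancilla contents. -/
noncomputable def acceptProb [NeZero n] (M : QFAA α n k) (w : List α) : ℝ :=
  ∑ y : Fin (tape w).length → Fin k, ∑ p ∈ M.acc, ‖M.amplitude (tape w) y p‖ ^ 2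

end QFAA

/-- The languages over `α` recognized with cutpoint `0` by quantum finite automata with
ancilla qubits. -/
def QFAA0 (α : Type*) : Set (Language α) :=
  {L | ∃ (n : ℕ) (_ : NeZero n) (k : ℕ) (M : QFAA α n k), L = langGT M.acceptProb 0}

end NQFA

/-!
The two equalities follow from the cycle of inclusions `S^≠ ⊆ NQL ⊆ QFA-A₀ ⊆ S^≠`.

* `SNe_subset_NQL`. The entries of the last vector of a PFA sum to `1`, so `f w - c` is a linear
  functional of that vector. It can be evaluated while the right end-marker is read, and stored
  in one extra coordinate, which becomes the only accepting state. Every matrix, scaled down to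
  a contraction, is the upper left block of a unitary matrix of twice the size
  (`exists_unitary_dilation`); the additional states are rejecting, so whatever leaks into them
  is discarded. The only contribution to the acceptance probability is then the square of a
  nonzero multiple of `f w - c`.
* `NQL_subset_QFAA0`. An automaton with ancillas simulates the intermediate measurements of a
  Kondacs–Watrous automaton exactly: the amplitude of a halting state is moved to an inert copy
  of that state, and the ancilla records whether the machine was still running.
* `QFAA0_subset_SNe`. The real density matrix of an automaton with ancillas evolves linearly, so
  its acceptance probability is a sum of entries of a product of real matrices
  (`QFAA.acceptFrom_eq_sum_superOp`). Turakainen's construction turns such a product into one of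
  stochastic matrices (`mem_SNe_of_matrices`): the tensor product of a matrix with
  `!![1, -1; -1, 1]` has vanishing row and column sums, hence both products with the uniform
  matrix `J` vanish, and a product of matrices `c • (T ⊗ₖ altMatrix) + J` is again of this form.
  With `c` small these matrices are stochastic, and since the acceptance probability is
  nonnegative, being positive means being different from `0`.
-/

namespace NQFA

open scoped Kronecker

/-! ### Automata over arbitrary finite state types -/

theorem exists_equiv_fin_zero {ι : Type*} [Fintype ι] (s : ι) :
    ∃ (n : ℕ) (_ : NeZero n) (e : ι ≃ Fin n), e s = 0 := by
  classical
  have : NeZero (Fintype.card ι) := ⟨(Fintype.card_pos_iff.2 ⟨s⟩).ne'⟩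
  refine ⟨Fintype.card ι, this, (Fintype.equivFin ι).trans
    (Equiv.swap (Fintype.equivFin ι s) 0), ?_⟩
  simp

variable {α : Type*}

theorem PFA.run_eq_vecMul_prod {n : ℕ} (P : PFA α n) (v : Fin n → ℝ) (x : List (TapeSym α)) :
    P.run v x = v ᵥ* (x.map P.A).prod := by
  induction x generalizing v with
  | nil => simp [PFA.run]
  | cons σ x ih =>
    have : P.run v (σ :: x) = P.run (v ᵥ* P.A σ) x := rfl
    rw [this, ih, List.map_cons, List.prod_cons, Matrix.vecMul_vecMul]

theorem mem_langNE {f : List α → ℝ} {c : ℝ} {w : List α} : w ∈ langNE f c ↔ f w ≠ c := by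
  rw [← lt_or_lt_iff_ne]
  rfl

/-- Stochastic matrices over an arbitrary finite index type with an arbitrary start index
define exclusive stochastic languages. -/
theorem mem_SNe_of_stochastic {ι : Type*} [Fintype ι] [DecidableEq ι] (s : ι)
    (A : TapeSym α → Matrix ι ι ℝ) (hA : ∀ σ, A σ ∈ Matrix.rowStochastic ℝ ι)
    (F : Finset ι) {c : ℝ} (hc : c ∈ Set.Icc (0 : ℝ) 1) {L : Language α}
    (hL : ∀ w, w ∈ L ↔ ∑ i ∈ F, ((tape w).map A).prod s i ≠ c) : L ∈ SNe α := by
  obtain ⟨n, hn, e, he⟩ := exists_equiv_fin_zero s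
  let P : PFA α n :=
    { A := fun σ => Matrix.reindexAlgEquiv ℝ ℝ e (A σ)
      stochastic := fun σ => by
        obtain ⟨h0, h1⟩ := Matrix.mem_rowStochastic_iff_sum.1 (hA σ)
        refine Matrix.mem_rowStochastic_iff_sum.2 ⟨fun i j => h0 _ _, fun i => ?_⟩
        rw [← h1 (e.symm i)]
        exact e.symm.sum_comp (fun j => A σ (e.symm i) j)
      acc := F.map e.toEmbedding }
  refine ⟨n, hn, P, c, hc, ?_⟩
  ext w
  rw [mem_langNE, hL]
  have hprod : ((tape w).map P.A).prod
      = Matrix.reindexAlgEquiv ℝ ℝ e ((tape w).map A).prod := by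
    rw [map_list_prod, List.map_map]
    rfl
  have hw : P.acceptProb w = ∑ i ∈ F, ((tape w).map A).prod s i := by
    simp only [PFA.acceptProb, PFA.run_eq_vecMul_prod, hprod, P, Finset.sum_map]
    simp [← he]
  rw [hw]

/-! ### From real matrices to stochastic matrices -/

/-- A matrix with vanishing row and column sums that is idempotent up to a positive factor. -/
def altMatrix : Matrix (Fin 2) (Fin 2) ℝ := !![1, -1; -1, 1]

theorem altMatrix_mul_self : altMatrix * altMatrix = (2 : ℝ) • altMatrix := by
  ext i j
  fin_cases i <;> fin_cases j <;> norm_num [altMatrix]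

theorem abs_altMatrix (i j : Fin 2) : |altMatrix i j| = 1 := by
  fin_cases i <;> fin_cases j <;> simp [altMatrix]

theorem sum_altMatrix_left (j : Fin 2) : ∑ i, altMatrix i j = 0 := by
  fin_cases j <;> simp [altMatrix]

theorem sum_altMatrix_right (i : Fin 2) : ∑ j, altMatrix i j = 0 := by
  fin_cases i <;> simp [altMatrix]

/-- The stochastic matrix all of whose entries are equal. -/
noncomputable def uniformMatrix (ι : Type*) [Fintype ι] : Matrix ι ι ℝ :=
  Matrix.of fun _ _ => (Fintype.card ι : ℝ)⁻¹

section Turakainen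

variable {ι : Type*} [Fintype ι]

theorem uniformMatrix_mul_self [Nonempty ι] :
    uniformMatrix ι * uniformMatrix ι = uniformMatrix ι := by
  ext i j
  simp [Matrix.mul_apply, uniformMatrix]

theorem kronecker_altMatrix_mul_uniformMatrix (T : Matrix ι ι ℝ) :
    (T ⊗ₖ altMatrix) * uniformMatrix (ι × Fin 2) = 0 := by
  ext i j
  simp only [Matrix.mul_apply, uniformMatrix, Matrix.of_apply, ← Finset.sum_mul,
    Fintype.sum_prod_type, Matrix.kroneckerMap_apply, ← Finset.mul_sum, sum_altMatrix_right]
  simp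

theorem uniformMatrix_mul_kronecker_altMatrix (T : Matrix ι ι ℝ) :
    uniformMatrix (ι × Fin 2) * (T ⊗ₖ altMatrix) = 0 := by
  ext i j
  simp only [Matrix.mul_apply, uniformMatrix, Matrix.of_apply, ← Finset.mul_sum,
    Fintype.sum_prod_type, Matrix.kroneckerMap_apply, sum_altMatrix_left]
  simp

theorem exists_smul_kronecker_add_uniform_mem_rowStochastic [DecidableEq ι] [Nonempty ι]
    (T : Matrix ι ι ℝ) : ∃ c : ℝ, 0 < c ∧
      c • (T ⊗ₖ altMatrix) + uniformMatrix (ι × Fin 2) ∈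
        Matrix.rowStochastic ℝ (ι × Fin 2) := by
  have hN : (0 : ℝ) < Fintype.card (ι × Fin 2) := by exact_mod_cast Fintype.card_pos
  set N : ℝ := (Fintype.card (ι × Fin 2) : ℝ) with hNdef
  -- `S` bounds all entries, so `c = 1 / ((1 + S) N)` keeps the perturbation below `1 / N`.
  set S : ℝ := ∑ i, ∑ j, |T i j|
  have hS : ∀ i j, |T i j| ≤ S := fun i j =>
    (Finset.single_le_sum (f := fun j => |T i j|) (fun _ _ => abs_nonneg _)
      (Finset.mem_univ j)).trans
    (Finset.single_le_sum (f := fun i => ∑ j, |T i j|)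
      (fun _ _ => Finset.sum_nonneg fun _ _ => abs_nonneg _) (Finset.mem_univ i))
  have hS0 : 0 ≤ S := Finset.sum_nonneg fun _ _ => Finset.sum_nonneg fun _ _ => abs_nonneg _
  have hc : 0 < (1 + S)⁻¹ * N⁻¹ := by positivity
  refine ⟨(1 + S)⁻¹ * N⁻¹, hc, Matrix.mem_rowStochastic_iff_sum.2 ⟨?_, ?_⟩⟩
  · rintro ⟨i, a⟩ ⟨j, b⟩
    have h1 : |(1 + S)⁻¹ * N⁻¹ * (T i j * altMatrix a b)| ≤ N⁻¹ := by
      rw [abs_mul, abs_mul (T i j), abs_altMatrix, mul_one, abs_of_pos hc]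
      calc (1 + S)⁻¹ * N⁻¹ * |T i j| = (1 + S)⁻¹ * |T i j| * N⁻¹ := by ring
        _ ≤ 1 * N⁻¹ := by
          gcongr
          rw [inv_mul_le_iff₀ (by positivity)]
          linarith [hS i j]
        _ = N⁻¹ := one_mul _
    have h2 := neg_le_of_abs_le h1
    simp only [Matrix.add_apply, Matrix.smul_apply, Matrix.kroneckerMap_apply, smul_eq_mul,
      uniformMatrix, Matrix.of_apply]
    linarith
  · rintro ⟨i, a⟩
    simp only [Matrix.add_apply, Matrix.smul_apply, Matrix.kroneckerMap_apply, smul_eq_mul,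
      uniformMatrix, Matrix.of_apply, Finset.sum_add_distrib, ← Finset.mul_sum,
      Fintype.sum_prod_type, sum_altMatrix_right]
    rw [← Fintype.sum_prod_type (f := fun _ : ι × Fin 2 => N⁻¹), Finset.sum_const,
      Finset.card_univ, nsmul_eq_mul, ← hNdef, mul_inv_cancel₀ hN.ne']
    simp

/-- The mixed terms of the product vanish, and the scalars and the factors `2` from
`altMatrix_mul_self` accumulate in `d`. The list has to be nonempty, because the identity matrix
is not of this form. -/
theorem exists_prod_kronecker_add_uniform [DecidableEq ι] [Nonempty ι] {β : Type*}
    (T : β → Matrix ι ι ℝ) (c : β → ℝ) (hc : ∀ b, 0 < c b) (b : β) (x : List β) :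
    ∃ d : ℝ, 0 < d ∧
      ((b :: x).map fun b => c b • (T b ⊗ₖ altMatrix) + uniformMatrix (ι × Fin 2)).prod
        = d • (((b :: x).map T).prod ⊗ₖ altMatrix) + uniformMatrix (ι × Fin 2) := by
  induction x generalizing b with
  | nil => exact ⟨c b, hc b, by simp⟩
  | cons b' x ih =>
    obtain ⟨d, hd, h⟩ := ih b'
    refine ⟨c b * d * 2, by have := hc b; positivity, ?_⟩
    rw [List.map_cons, List.prod_cons, h, List.map_cons (f := T), List.prod_cons, add_mul,
      mul_add, mul_add, smul_mul_assoc, smul_mul_assoc, mul_smul_comm, mul_smul_comm,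
      kronecker_altMatrix_mul_uniformMatrix, uniformMatrix_mul_kronecker_altMatrix,
      uniformMatrix_mul_self, ← Matrix.mul_kronecker_mul, altMatrix_mul_self,
      Matrix.kronecker_smul, smul_smul, smul_smul]
    simp

/-- Turakainen's theorem for automata with end-markers: the words at which a sum of entries of
a product of arbitrary real matrices does not vanish form an exclusive stochastic language. -/
theorem mem_SNe_of_matrices [DecidableEq ι] (s : ι) (T : TapeSym α → Matrix ι ι ℝ)
    (F : Finset ι) {L : Language α}
    (hL : ∀ w, w ∈ L ↔ ∑ i ∈ F, ((tape w).map T).prod s i ≠ 0) : L ∈ SNe α := by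
  have : Nonempty ι := ⟨s⟩
  choose c hc hstoch using fun σ => exists_smul_kronecker_add_uniform_mem_rowStochastic (T σ)
  set F' : Finset (ι × Fin 2) := F ×ˢ {0} with hF'
  have hN : (0 : ℝ) < Fintype.card (ι × Fin 2) := by exact_mod_cast Fintype.card_pos
  -- The summand `uniformMatrix` contributes the constant `|F'| / N`, which is the cutpoint.
  have hcut : (F'.card : ℝ) * (Fintype.card (ι × Fin 2) : ℝ)⁻¹ ∈ Set.Icc (0 : ℝ) 1 := by
    refine ⟨by positivity, ?_⟩
    rw [← div_eq_mul_inv, div_le_one hN]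
    exact_mod_cast Finset.card_le_univ F'
  refine mem_SNe_of_stochastic (s, 0) _ hstoch F' hcut fun w => ?_
  obtain ⟨d, hd, h⟩ := exists_prod_kronecker_add_uniform T c hc TapeSym.cent
    (w.map TapeSym.sym ++ [TapeSym.dollar])
  have hval : ∑ i ∈ F', ((tape w).map fun σ =>
      c σ • (T σ ⊗ₖ altMatrix) + uniformMatrix (ι × Fin 2)).prod (s, 0) i
      = d * ∑ i ∈ F, ((tape w).map T).prod s i
        + F'.card * (Fintype.card (ι × Fin 2) : ℝ)⁻¹ := by
    rw [show tape w = TapeSym.cent :: (w.map TapeSym.sym ++ [TapeSym.dollar]) from rfl, h]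
    simp only [Matrix.add_apply, Finset.sum_add_distrib]
    congr 1
    · simp [hF', altMatrix, Finset.mul_sum]
    · simp [uniformMatrix]
  rw [hL, hval, Ne, Ne, add_eq_right, mul_eq_zero, or_iff_right hd.ne']

end Turakainen

/-! ### Unitary dilation -/

open scoped MatrixOrder Matrix.Norms.L2Operator in
/-- A matrix scaled to a contraction is the upper block of an isometry; the lower block is a
square root of the defect `1 - (ε B)ᴴ (ε B)`. -/
theorem exists_isometry_block {κ : Type*} [Fintype κ] [DecidableEq κ] (B : Matrix κ κ ℂ) :
    ∃ ε : ℝ, 0 < ε ∧ ∃ C : Matrix κ κ ℂ,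
      ((ε : ℂ) • B)ᴴ * ((ε : ℂ) • B) + Cᴴ * C = 1 := by
  have hε : 0 < (1 + ‖B‖)⁻¹ := by positivity
  set ε : ℝ := (1 + ‖B‖)⁻¹ with hεdef
  have hnorm : ‖(ε : ℂ) • B‖ ≤ 1 := by
    rw [norm_smul, Complex.norm_real, Real.norm_of_nonneg hε.le, hεdef,
      inv_mul_le_iff₀ (by positivity)]
    linarith
  have hle : star ((ε : ℂ) • B) * ((ε : ℂ) • B) ≤ 1 := by
    rw [← CStarAlgebra.norm_le_one_iff_of_nonneg _ (star_mul_self_nonneg _),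
      CStarRing.norm_star_mul_self]
    exact mul_le_one₀ hnorm (norm_nonneg _) hnorm
  obtain ⟨C, hC⟩ := CStarAlgebra.nonneg_iff_eq_star_mul_self.1 (sub_nonneg.2 hle)
  refine ⟨ε, hε, C, ?_⟩
  rw [← Matrix.star_eq_conjTranspose, ← Matrix.star_eq_conjTranspose, ← hC]
  abel

theorem exists_unitary_of_orthonormal_columns {ι κ : Type*} [Fintype ι] [DecidableEq ι]
    [Fintype κ] [DecidableEq κ] (V : Matrix (ι ⊕ κ) ι ℂ) (hV : Vᴴ * V = 1) :
    ∃ U ∈ Matrix.unitaryGroup (ι ⊕ κ) ℂ, ∀ i j, U i (Sum.inl j) = V i j := by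
  let v : ι ⊕ κ → EuclideanSpace ℂ (ι ⊕ κ) :=
    Sum.elim (fun j => WithLp.toLp 2 fun i => V i j) 0
  have hv : Orthonormal ℂ ((Set.range (Sum.inl : ι → ι ⊕ κ)).domRestrict v) := by
    rw [orthonormal_iff_ite]
    rintro ⟨_, i, rfl⟩ ⟨_, j, rfl⟩
    have h := congrFun (congrFun hV i) j
    rw [Matrix.mul_apply, Matrix.one_apply] at h
    refine Eq.trans ?_ (h.trans (if_congr (Subtype.ext_iff.trans Sum.inl.inj_iff).symm rfl rfl))
    rw [PiLp.inner_apply]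
    exact Finset.sum_congr rfl fun k _ => mul_comm _ _
  obtain ⟨b, hb⟩ := hv.exists_orthonormalBasis_extension_of_card_eq (by simp)
  refine ⟨Matrix.of fun i j => b j i, Matrix.mem_unitaryGroup_iff'.2 ?_, fun i j => ?_⟩
  · ext i j
    have h := orthonormal_iff_ite.1 b.orthonormal i j
    rw [Matrix.one_apply, ← h, PiLp.inner_apply, Matrix.mul_apply]
    exact Finset.sum_congr rfl fun k _ => mul_comm _ _
  · simp [hb _ (Set.mem_range_self j), v]

/-- Every square matrix is, up to a positive factor, the upper left block of a unitary matrix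
of twice the size. -/
theorem exists_unitary_dilation {κ : Type*} [Fintype κ] [DecidableEq κ] (B : Matrix κ κ ℂ) :
    ∃ ε : ℝ, 0 < ε ∧ ∃ U ∈ Matrix.unitaryGroup (κ ⊕ κ) ℂ,
      ∀ i j, U (Sum.inl i) (Sum.inl j) = ε * B i j := by
  obtain ⟨ε, hε, C, hC⟩ := exists_isometry_block B
  obtain ⟨U, hU, h⟩ := exists_unitary_of_orthonormal_columns
    (Matrix.fromRows ((ε : ℂ) • B) C) (by
      rw [Matrix.conjTranspose_fromRows_eq_fromCols_conjTranspose, Matrix.fromCols_mul_fromRows,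
        hC])
  exact ⟨ε, hε, U, hU, fun i j => by simp [h]⟩

/-! ### Acceptance by automata with ancillas as a linear function of density matrices -/

namespace QFAA
variable {α : Type*} {n k : ℕ}

/-- The total acceptance probability over all ancilla contents when the rest of the tape is `x`
and the (unnormalized) state vector is `ψ`, computed by recursion on the tape. -/
noncomputable def acceptFrom (M : QFAA α n k) : (Fin n → ℂ) → List (TapeSym α) → ℝ
  | ψ, [] => ∑ p ∈ M.acc, ‖ψ p‖ ^ 2
  | ψ, σ :: x => ∑ ω, M.acceptFrom (M.step ψ (σ, ω)) x

theorem sum_foldl_step_eq_acceptFrom (M : QFAA α n k) (ψ : Fin n → ℂ) (x : List (TapeSym α)) :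
    ∑ y : Fin x.length → Fin k, ∑ p ∈ M.acc, ‖(x.zip (List.ofFn y)).foldl M.step ψ p‖ ^ 2
      = M.acceptFrom ψ x := by
  induction x generalizing ψ with
  | nil => simp [acceptFrom]
  | cons σ x ih =>
    refine ((Fin.consEquiv fun _ : Fin (x.length + 1) => Fin k).sum_comp _).symm.trans ?_
    rw [Fintype.sum_prod_type]
    simp only [acceptFrom, ← ih]
    simp [Fin.consEquiv, List.ofFn_succ]

theorem acceptProb_eq_acceptFrom [NeZero n] (M : QFAA α n k) (w : List α) :
    M.acceptProb w = M.acceptFrom (Pi.single 0 1) (tape w) :=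
  M.sum_foldl_step_eq_acceptFrom _ _

theorem acceptFrom_nonneg (M : QFAA α n k) (ψ : Fin n → ℂ) (x : List (TapeSym α)) :
    0 ≤ M.acceptFrom ψ x := by
  induction x generalizing ψ with
  | nil => exact Finset.sum_nonneg fun _ _ => by positivity
  | cons σ x ih => exact Finset.sum_nonneg fun _ _ => ih _

end QFAA

/-- The real and imaginary parts of a complex vector, as one real vector: index `(i, 0)` holds
the real part and `(i, 1)` the imaginary part of entry `i`. -/
def realify {ι : Type*} (ψ : ι → ℂ) : ι × Fin 2 → ℝ := fun i => ![(ψ i.1).re, (ψ i.1).im] i.2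

/-- The rank-one matrix `v vᵀ`, as a vector indexed by pairs. -/
def densityVec {κ : Type*} (v : κ → ℝ) : κ × κ → ℝ := fun i => v i.1 * v i.2

theorem densityVec_vecMul_kronecker {κ : Type*} [Fintype κ] (v : κ → ℝ) (R : Matrix κ κ ℝ) :
    densityVec v ᵥ* (R ⊗ₖ R) = densityVec (v ᵥ* R) := by
  ext ⟨i, j⟩
  simp only [Matrix.vecMul, dotProduct, densityVec, Matrix.kroneckerMap_apply,
    Fintype.sum_prod_type, Finset.sum_mul_sum]
  exact Finset.sum_congr rfl fun _ _ => Finset.sum_congr rfl fun _ _ => by ring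

namespace QFAA
variable {α : Type*} {n k : ℕ}

/-- The real matrix, acting on row vectors `realify ψ`, of the branch of a step in which the
ancilla symbol `ω` is written. -/
def realStep (M : QFAA α n k) (σ : TapeSym α) (ω : Fin k) :
    Matrix (Fin n × Fin 2) (Fin n × Fin 2) ℝ :=
  Matrix.of fun i j =>
    !![(M.δ i.1 σ j.1 ω).re, (M.δ i.1 σ j.1 ω).im;
       -(M.δ i.1 σ j.1 ω).im, (M.δ i.1 σ j.1 ω).re] i.2 j.2

theorem realify_step (M : QFAA α n k) (ψ : Fin n → ℂ) (σ : TapeSym α) (ω : Fin k) :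
    realify (M.step ψ (σ, ω)) = realify ψ ᵥ* M.realStep σ ω := by
  ext ⟨p, b⟩
  simp only [Matrix.vecMul, dotProduct, Fintype.sum_prod_type, Fin.sum_univ_two, realify, step,
    realStep, Matrix.of_apply, Complex.re_sum, Complex.im_sum, Complex.mul_re, Complex.mul_im]
  fin_cases b
  · simp [sub_eq_add_neg, mul_comm]
  · simp [add_comm, mul_comm]

/-- The action of a step on density vectors (as row vectors), with the ancilla traced out. -/
def superOp (M : QFAA α n k) (σ : TapeSym α) :
    Matrix ((Fin n × Fin 2) × (Fin n × Fin 2)) ((Fin n × Fin 2) × (Fin n × Fin 2)) ℝ :=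
  ∑ ω, M.realStep σ ω ⊗ₖ M.realStep σ ω

/-- The diagonal positions of the real density matrix that belong to accepting states. -/
def diagAcc (M : QFAA α n k) : Finset ((Fin n × Fin 2) × (Fin n × Fin 2)) :=
  (M.acc ×ˢ Finset.univ).map ⟨fun i => (i, i), fun _ _ h => congrArg Prod.fst h⟩

theorem acceptFrom_eq_sum_superOp (M : QFAA α n k) (ψ : Fin n → ℂ) (x : List (TapeSym α)) :
    M.acceptFrom ψ x
      = ∑ i ∈ M.diagAcc, (densityVec (realify ψ) ᵥ* (x.map M.superOp).prod) i := by
  induction x generalizing ψ with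
  | nil =>
    simp only [acceptFrom, diagAcc, Finset.sum_map, Finset.sum_product, List.map_nil,
      List.prod_nil, Matrix.vecMul_one, Fin.sum_univ_two, Complex.sq_norm, Complex.normSq_apply]
    rfl
  | cons σ x ih =>
    rw [List.map_cons, List.prod_cons, ← Matrix.vecMul_vecMul]
    simp only [acceptFrom, ih, realify_step, ← densityVec_vecMul_kronecker, superOp]
    rw [Finset.sum_comm]
    simp only [Matrix.vecMul_sum, Matrix.sum_vecMul, Finset.sum_apply]

end QFAA

theorem QFAA0_subset_SNe (α : Type*) : QFAA0 α ⊆ SNe α := by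
  rintro L ⟨n, hn, k, M, rfl⟩
  refine mem_SNe_of_matrices ((0, 0), (0, 0)) M.superOp M.diagAcc fun w => ?_
  have hinit : densityVec (realify (Pi.single (0 : Fin n) (1 : ℂ)))
      = Pi.single ((0, 0), (0, 0)) 1 := by
    ext ⟨⟨p, a⟩, ⟨q, b⟩⟩
    rcases eq_or_ne p 0 with rfl | hp <;> rcases eq_or_ne q 0 with rfl | hq <;>
      fin_cases a <;> fin_cases b <;> simp_all [densityVec, realify]
  have h : M.acceptProb w
      = ∑ i ∈ M.diagAcc, ((tape w).map M.superOp).prod ((0, 0), (0, 0)) i := by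
    simp [M.acceptProb_eq_acceptFrom, M.acceptFrom_eq_sum_superOp, hinit]
  rw [← h]
  change 0 < M.acceptProb w ↔ _
  rw [M.acceptProb_eq_acceptFrom]
  exact (M.acceptFrom_nonneg _ _).lt_iff_ne'

/-! ### Deferring the measurements of a Kondacs–Watrous automaton -/

namespace KWQFA
variable {α : Type*} {n : ℕ}

/-- Transition amplitudes on running states (`Sum.inl`) and inert copies of the states
(`Sum.inr`). A running state makes the step of `M` and writes `0`; where `M` halts, it enters the
inert copy. An inert state stays put and writes `1`, which keeps the images of the running and of
the inert states orthogonal. -/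
def recordAmplitude (M : KWQFA α n) (σ : TapeSym α) :
    Fin n ⊕ Fin n → Fin n ⊕ Fin n → Fin 2 → ℂ
  | Sum.inl q, Sum.inl p, 0 => if p ∈ M.acc ∪ M.rej then 0 else M.U σ p q
  | Sum.inl q, Sum.inr p, 0 => if p ∈ M.acc ∪ M.rej then M.U σ p q else 0
  | Sum.inr q, Sum.inr p, 1 => if p = q then 1 else 0
  | _, _, _ => 0

theorem recordAmplitude_isometry (M : KWQFA α n) (σ : TapeSym α) (q₁ q₂ : Fin n ⊕ Fin n) :
    ∑ p, ∑ ω, (starRingEnd ℂ) (M.recordAmplitude σ q₁ p ω) * M.recordAmplitude σ q₂ p ω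
      = if q₁ = q₂ then 1 else 0 := by
  rw [Fintype.sum_sum_type]
  simp only [Fin.sum_univ_two]
  rcases q₁ with q₁ | q₁ <;> rcases q₂ with q₂ | q₂
  · have h := congrFun (congrFun (Matrix.mem_unitaryGroup_iff'.1 (M.unitary σ)) q₁) q₂
    rw [Matrix.mul_apply, Matrix.one_apply] at h
    rw [← Finset.sum_add_distrib]
    refine Eq.trans (Finset.sum_congr rfl fun p _ => ?_)
      (h.trans (if_congr Sum.inl_injective.eq_iff.symm rfl rfl))
    by_cases hp : p ∈ M.acc ∪ M.rej <;> simp [recordAmplitude, hp, Matrix.star_apply]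
  · simp [recordAmplitude]
  · simp [recordAmplitude]
  · simp [recordAmplitude, eq_comm]

/-- The automaton with ancillas that defers the measurements of `M`. -/
noncomputable def toQFAA (M : KWQFA α n) : QFAA α (n + n) 2 where
  δ q σ p ω := M.recordAmplitude σ (finSumFinEquiv.symm q) (finSumFinEquiv.symm p) ω
  wellFormed σ q₁ q₂ := by
    rw [← if_congr finSumFinEquiv.symm.injective.eq_iff rfl rfl,
      ← M.recordAmplitude_isometry σ]
    exact finSumFinEquiv.symm.sum_comp (fun p => ∑ ω, (starRingEnd ℂ)
      (M.recordAmplitude σ (finSumFinEquiv.symm q₁) p ω) *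
        M.recordAmplitude σ (finSumFinEquiv.symm q₂) p ω)
  acc := (M.acc.map Function.Embedding.inr).map finSumFinEquiv.toEmbedding

/-- The part of a state vector on which the machine halts, complementary to `nonHalting`. -/
noncomputable def halted (M : KWQFA α n) (ψ : Fin n → ℂ) : Fin n → ℂ :=
  fun q => if q ∈ M.acc ∪ M.rej then ψ q else 0

theorem toQFAA_step_zero (M : KWQFA α n) (φ χ : Fin n → ℂ) (σ : TapeSym α) :
    M.toQFAA.step (Sum.elim φ χ ∘ finSumFinEquiv.symm) (σ, 0)
      = Sum.elim (M.nonHalting (M.U σ *ᵥ φ)) (M.halted (M.U σ *ᵥ φ))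
        ∘ finSumFinEquiv.symm := by
  ext p
  obtain ⟨p, rfl⟩ := finSumFinEquiv.surjective p
  simp only [QFAA.step, toQFAA, Function.comp_apply, Equiv.symm_apply_apply]
  rw [finSumFinEquiv.symm.sum_comp (fun q => M.recordAmplitude σ q p 0 * Sum.elim φ χ q),
    Fintype.sum_sum_type]
  rcases p with p | p <;> by_cases hp : p ∈ M.acc ∪ M.rej <;>
    simp [recordAmplitude, nonHalting, halted, Matrix.mulVec, dotProduct, hp]

theorem toQFAA_step_one (M : KWQFA α n) (φ χ : Fin n → ℂ) (σ : TapeSym α) :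
    M.toQFAA.step (Sum.elim φ χ ∘ finSumFinEquiv.symm) (σ, 1)
      = Sum.elim (0 : Fin n → ℂ) χ ∘ finSumFinEquiv.symm := by
  ext p
  obtain ⟨p, rfl⟩ := finSumFinEquiv.surjective p
  simp only [QFAA.step, toQFAA, Function.comp_apply, Equiv.symm_apply_apply]
  rw [finSumFinEquiv.symm.sum_comp (fun q => M.recordAmplitude σ q p 1 * Sum.elim φ χ q),
    Fintype.sum_sum_type]
  rcases p with p | p <;> simp [recordAmplitude]

theorem nonHalting_zero (M : KWQFA α n) : M.nonHalting 0 = 0 := by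
  ext q
  simp [nonHalting]

theorem acceptFrom_zero (M : KWQFA α n) (x : List (TapeSym α)) : M.acceptFrom 0 x = 0 := by
  induction x with
  | nil => rfl
  | cons σ x ih => simp [acceptFrom, nonHalting_zero, ih]

/-- The inert part `χ` keeps the acceptance probability collected so far. -/
theorem toQFAA_acceptFrom (M : KWQFA α n) (φ χ : Fin n → ℂ) (x : List (TapeSym α)) :
    M.toQFAA.acceptFrom (Sum.elim φ χ ∘ finSumFinEquiv.symm) x
      = M.acceptFrom φ x + ∑ q ∈ M.acc, ‖χ q‖ ^ 2 := by
  induction x generalizing φ χ with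
  | nil => simp [QFAA.acceptFrom, acceptFrom, toQFAA]
  | cons σ x ih =>
    have h : ∑ q ∈ M.acc, ‖M.halted (M.U σ *ᵥ φ) q‖ ^ 2
        = ∑ q ∈ M.acc, ‖(M.U σ *ᵥ φ) q‖ ^ 2 :=
      Finset.sum_congr rfl fun q hq => by simp [halted, hq]
    rw [QFAA.acceptFrom, Fin.sum_univ_two, toQFAA_step_zero, toQFAA_step_one, ih, ih, h,
      acceptFrom_zero, acceptFrom]
    ring

theorem toQFAA_acceptProb [NeZero n] [NeZero (n + n)] (M : KWQFA α n) (w : List α) :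
    M.toQFAA.acceptProb w = M.acceptProb w := by
  have hinit : (Pi.single 0 1 : Fin (n + n) → ℂ)
      = Sum.elim (Pi.single 0 1) 0 ∘ finSumFinEquiv.symm := by
    ext q
    obtain ⟨q, rfl⟩ := finSumFinEquiv.surjective q
    have h0 : (0 : Fin (n + n)) = finSumFinEquiv (Sum.inl 0) := rfl
    rw [h0, Function.comp_apply, Equiv.symm_apply_apply]
    rcases q with q | q
    · simp [Pi.single_apply]
    · rw [Pi.single_eq_of_ne (by simp [-finSumFinEquiv_apply_left, -finSumFinEquiv_apply_right])]
      rfl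
  rw [QFAA.acceptProb_eq_acceptFrom, hinit, toQFAA_acceptFrom]
  simp [acceptProb]

end KWQFA

theorem NQL_subset_QFAA0 (α : Type*) : NQL α ⊆ QFAA0 α := by
  rintro L ⟨n, hn, M, rfl⟩
  have : NeZero (n + n) := ⟨by have := hn.ne; omega⟩
  refine ⟨n + n, this, 2, M.toQFAA, ?_⟩
  rw [funext M.toQFAA_acceptProb]

/-! ### Kondacs–Watrous automata from probabilistic automata -/

namespace PFA
variable {α : Type*} {n : ℕ}

/-- The matrices of `P`, transposed to act on column vectors, with an additional coordinate
`none`. Reading `$` maps a vector `v` to `v A_$ η` in that coordinate; before that the coordinate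
stays `0`. -/
def cutMatrix (P : PFA α n) (η : Fin n → ℝ) :
    TapeSym α → Matrix (Option (Fin n)) (Option (Fin n)) ℂ
  | TapeSym.dollar, none, some i => ((P.A TapeSym.dollar *ᵥ η) i : ℝ)
  | TapeSym.cent, some j, some i => (P.A TapeSym.cent i j : ℝ)
  | TapeSym.sym a, some j, some i => (P.A (TapeSym.sym a) i j : ℝ)
  | _, _, _ => 0

/-- A real vector as a complex one, extended by `0` in the coordinate `none`. -/
def activeVec (v : Fin n → ℝ) : Option (Fin n) → ℂ
  | none => 0
  | some i => (v i : ℝ)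

theorem cutMatrix_mulVec_dollar (P : PFA α n) (η v : Fin n → ℝ) :
    (P.cutMatrix η TapeSym.dollar *ᵥ activeVec v) none
      = ((v ⬝ᵥ (P.A TapeSym.dollar *ᵥ η) : ℝ) : ℂ) := by
  simp [Matrix.mulVec, dotProduct, Fintype.sum_option, cutMatrix, activeVec, mul_comm]

theorem cutMatrix_mulVec (P : PFA α n) (η v : Fin n → ℝ) {σ : TapeSym α}
    (hσ : σ ≠ TapeSym.dollar) :
    P.cutMatrix η σ *ᵥ activeVec v = activeVec (v ᵥ* P.A σ) := by
  ext i
  rcases σ with _ | a | _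
  · rcases i with _ | i <;>
    simp [Matrix.mulVec, Matrix.vecMul, dotProduct, Fintype.sum_option, cutMatrix, activeVec,
      mul_comm]
  · rcases i with _ | i <;>
    simp [Matrix.mulVec, Matrix.vecMul, dotProduct, Fintype.sum_option, cutMatrix, activeVec,
      mul_comm]
  · exact absurd rfl hσ

theorem activeVec_smul (c : ℝ) (v : Fin n → ℝ) :
    activeVec (c • v) = (c : ℂ) • activeVec v := by
  ext i
  rcases i with _ | i <;> simp [activeVec]

end PFA

/-- In the state labelling `e`, the automaton `M` performs the scaled matrix `ε σ • B σ` on the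
left summand, accepts exactly in the coordinate `none` of that summand, and rejects on the whole
right summand. -/
structure KWQFA.IsDilation {α : Type*} {N : ℕ} {κ : Type*} (M : KWQFA α N)
    (e : Option κ ⊕ Option κ ≃ Fin N)
    (ε : TapeSym α → ℝ) (B : TapeSym α → Matrix (Option κ) (Option κ) ℂ) : Prop where
  pos : ∀ σ, 0 < ε σ
  block : ∀ σ i j, M.U σ (e (Sum.inl i)) (e (Sum.inl j)) = ε σ * B σ i j
  acc : M.acc = {e (Sum.inl none)}
  mem_rej : ∀ q, q ∈ M.rej ↔ ∃ i, q = e (Sum.inr i)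

theorem KWQFA.exists_isDilation {α κ : Type*} [Fintype κ] (s : κ)
    (B : TapeSym α → Matrix (Option κ) (Option κ) ℂ) :
    ∃ (N : ℕ) (_ : NeZero N) (M : KWQFA α N) (e : Option κ ⊕ Option κ ≃ Fin N)
      (ε : TapeSym α → ℝ), e (Sum.inl (some s)) = 0 ∧ M.IsDilation e ε B := by
  classical
  choose ε hε V hV hblock using fun σ => exists_unitary_dilation (B σ)
  obtain ⟨N, hN, e, he⟩ := exists_equiv_fin_zero (Sum.inl (some s) : Option κ ⊕ Option κ)
  let M : KWQFA α N :=
    { U := fun σ => Matrix.reindex e e (V σ)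
      unitary := fun σ => by
        rw [Matrix.mem_unitaryGroup_iff', Matrix.star_eq_conjTranspose,
          Matrix.conjTranspose_reindex, Matrix.reindex_apply, Matrix.reindex_apply,
          Matrix.submatrix_mul_equiv, ← Matrix.star_eq_conjTranspose,
          Matrix.mem_unitaryGroup_iff'.1 (hV σ), Matrix.submatrix_one_equiv]
      acc := {e (Sum.inl none)}
      rej := Finset.univ.image fun i => e (Sum.inr i)
      disjoint := by simp }
  exact ⟨N, hN, M, e, ε, he, hε, fun σ i j => by simp [M, hblock], rfl,
    fun q => by simp [M, eq_comm]⟩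

namespace KWQFA.IsDilation

variable {α : Type*} {N : ℕ} {κ : Type*} [Fintype κ] {M : KWQFA α N}
  {e : Option κ ⊕ Option κ ≃ Fin N}
  {ε : TapeSym α → ℝ} {B : TapeSym α → Matrix (Option κ) (Option κ) ℂ}

theorem mulVec_inl (h : M.IsDilation e ε B) (σ : TapeSym α) (φ : Option κ → ℂ) (i : Option κ) :
    (M.U σ *ᵥ (Sum.elim φ 0 ∘ e.symm)) (e (Sum.inl i)) = ε σ * (B σ *ᵥ φ) i := by
  simp only [Matrix.mulVec, dotProduct, Finset.mul_sum]
  rw [← e.sum_comp, Fintype.sum_sum_type]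
  simp [h.block, mul_assoc]

theorem acceptFrom_cons (h : M.IsDilation e ε B) (σ : TapeSym α) (φ : Option κ → ℂ)
    (x : List (TapeSym α)) :
    M.acceptFrom (Sum.elim φ 0 ∘ e.symm) (σ :: x) = ‖ε σ * (B σ *ᵥ φ) none‖ ^ 2 +
      M.acceptFrom (M.nonHalting (M.U σ *ᵥ (Sum.elim φ 0 ∘ e.symm))) x := by
  rw [KWQFA.acceptFrom, h.acc, Finset.sum_singleton, h.mulVec_inl]

theorem nonHalting_mulVec (h : M.IsDilation e ε B) (σ : TapeSym α) (φ : Option κ → ℂ)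
    (h0 : (B σ *ᵥ φ) none = 0) :
    M.nonHalting (M.U σ *ᵥ (Sum.elim φ 0 ∘ e.symm))
      = Sum.elim ((ε σ : ℂ) • (B σ *ᵥ φ)) 0 ∘ e.symm := by
  ext q
  obtain ⟨q, rfl⟩ := e.surjective q
  have hmem : e q ∈ M.acc ∪ M.rej ↔ q = Sum.inl none ∨ ∃ i, q = Sum.inr i := by
    simp [h.acc, h.mem_rej]
  rcases q with (_ | q) | q
  · simp [KWQFA.nonHalting, hmem, h0]
  · simp [KWQFA.nonHalting, hmem, h.mulVec_inl]
  · simp [KWQFA.nonHalting, hmem]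

/-- The acceptance probability before `$` is zero, and reading `$` contributes the square of a
nonzero multiple of the value of the functional `η`. -/
theorem acceptFrom_pos_iff {n : ℕ} {P : PFA α n} {η : Fin n → ℝ}
    {e : Option (Fin n) ⊕ Option (Fin n) ≃ Fin N}
    (h : M.IsDilation e ε (P.cutMatrix η)) (v : Fin n → ℝ) (x : List (TapeSym α))
    (hx : ∀ σ ∈ x, σ ≠ TapeSym.dollar) :
    0 < M.acceptFrom (Sum.elim (PFA.activeVec v) 0 ∘ e.symm) (x ++ [TapeSym.dollar]) ↔
      P.run v (x ++ [TapeSym.dollar]) ⬝ᵥ η ≠ 0 := by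
  simp only [PFA.run_eq_vecMul_prod]
  induction x generalizing v with
  | nil =>
    have := h.pos TapeSym.dollar
    rw [List.nil_append, h.acceptFrom_cons, P.cutMatrix_mulVec_dollar, KWQFA.acceptFrom,
      ← Complex.ofReal_mul, Complex.norm_real, add_zero, sq_pos_iff, norm_ne_zero_iff,
      mul_ne_zero_iff_left this.ne', Matrix.dotProduct_mulVec]
    simp
  | cons σ x ih =>
    have hσ := P.cutMatrix_mulVec η v (hx σ List.mem_cons_self)
    have h0 : (P.cutMatrix η σ *ᵥ PFA.activeVec v) none = 0 := by rw [hσ]; rfl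
    rw [List.cons_append, h.acceptFrom_cons, h.nonHalting_mulVec σ _ h0, h0, hσ,
      ← PFA.activeVec_smul, mul_zero, norm_zero, zero_pow two_ne_zero, zero_add,
      ih _ fun τ hτ => hx τ (List.mem_cons_of_mem _ hτ), List.map_cons, List.prod_cons,
      ← Matrix.vecMul_vecMul, Matrix.smul_vecMul, smul_dotProduct, smul_eq_mul,
      mul_ne_zero_iff_left (h.pos σ).ne']

end KWQFA.IsDilation

namespace PFA

variable {α : Type*} {n : ℕ}

theorem sum_run_eq_one [NeZero n] (P : PFA α n) (x : List (TapeSym α)) :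
    ∑ i, P.run (Pi.single 0 1) x i = 1 := by
  have hmem : (x.map P.A).prod ∈ Matrix.rowStochastic ℝ (Fin n) :=
    Submonoid.list_prod_mem _ fun A hA => by
      obtain ⟨σ, -, rfl⟩ := List.mem_map.1 hA
      exact P.stochastic σ
  rw [run_eq_vecMul_prod, Matrix.single_one_vecMul]
  exact (Matrix.mem_rowStochastic_iff_sum.1 hmem).2 0

/-- Since the entries of the final vector sum to `1`, subtracting `c` from every weight
subtracts `c` from the acceptance probability. -/
theorem run_dotProduct_eq_acceptProb_sub [NeZero n] (P : PFA α n) (c : ℝ) (w : List α) :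
    P.run (Pi.single 0 1) (tape w) ⬝ᵥ (fun i => (if i ∈ P.acc then 1 else 0) - c)
      = P.acceptProb w - c := by
  simp [dotProduct, mul_sub, Finset.sum_sub_distrib, ← Finset.sum_mul, sum_run_eq_one,
    acceptProb]

end PFA

theorem SNe_subset_NQL (α : Type*) : SNe α ⊆ NQL α := by
  rintro L ⟨n, hn, P, c, -, rfl⟩
  obtain ⟨N, hN, M, e, ε, he, h⟩ := KWQFA.exists_isDilation (0 : Fin n)
    (P.cutMatrix fun i => (if i ∈ P.acc then 1 else 0) - c)
  refine ⟨N, hN, M, ?_⟩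
  ext w
  have hinit : (Pi.single 0 1 : Fin N → ℂ)
      = Sum.elim (PFA.activeVec (Pi.single 0 1)) 0 ∘ e.symm := by
    ext q
    obtain ⟨q, rfl⟩ := e.surjective q
    rw [← he, Function.comp_apply, Equiv.symm_apply_apply]
    rcases q with (_ | q) | q <;> simp [Pi.single_apply, PFA.activeVec, apply_ite Complex.ofReal]
  have hpos := h.acceptFrom_pos_iff (Pi.single 0 1) (TapeSym.cent :: w.map TapeSym.sym)
    (by simp)
  rw [← hinit] at hpos
  rw [mem_langNE, ← sub_ne_zero, ← P.run_dotProduct_eq_acceptProb_sub]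
  exact hpos.symm

end NQFA

theorem mainTheorem3 (α : Type*) [Finite α] :
    NQFA.QFAA0 α = NQFA.NQL α ∧ NQFA.NQL α = NQFA.SNe α := by
  have h₁ := NQFA.SNe_subset_NQL α
  have h₂ := NQFA.NQL_subset_QFAA0 α
  have h₃ := NQFA.QFAA0_subset_SNe α
  exact ⟨(h₃.trans h₁).antisymm h₂, (h₂.trans h₃).antisymm h₁⟩
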